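/- Let $t\ge 0$ be an integer and let $\sigma=\sigma_t$ be the substitution $1\mapsto 1^{t+1}2,\ 2\mapsto 3,\ 3\mapsto 4,\ 4\mapsto 1^t5,\ 5\mapsto 1$ on $\mathcal A=\{1,\dots,5\}$. Let $M$ be its incidence matrix, $M_{b,a}=|\sigma(a)|_b$, whose characteristic polynomial is $f(x)g(x)$ with $f(x)=x^3-tx^2-(t+1)x-1$ and $g(x)=x^2-x+1$. Let $\beta>1$ be the largest real root of $f$. Write $\mathbb R^5=\mathbb K_e\oplus\mathbb K_c\oplus\mathbb K_n$, where $\mathbb K_e$ is the eigenspace of $M$ for $\beta$, $\mathbb K_c$ is the (two-dimensional) real subspace spanned by the eigenspaces for the roots of $f$ other than $\beta$, and $\mathbb K_n=f(M)\mathbb R^5$. Let $\pi_c$ be the projection onto $\mathbb K_c$ along $\mathbb K_e\oplus\mathbb K_n$, let $\lambda$ be the Lebesgue measure on $\mathbb K_c$, and for a finite word $v=v_0\cdots v_{k-1}$ let $\mathbf l(v)=\mathbf e_{v_0}+\dots+\mathbf e_{v_{k-1}}$. Let $u\in\mathcal A^{\mathbb N}$ be a fixed point of $\sigma$, and let $w=\chi(u)$,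 where $\chi$ is the morphism $1\mapsto 34,\ 5\mapsto 32,\ 2\mapsto2,\ 3\mapsto 3,\ 4\mapsto 4$. Put $$\mathcal R(a)=\overline{\{\pi_c(\mathbf l(u_0\cdots u_{N-1})): N\ge 0,\ u_N=a\}}\quad(a\in\mathcal A),\qquad \mathcal R=\bigcup_{a\in\mathcal A}\mathcal R(a),$$ $$\widetilde{\mathcal R}(a)=\overline{\{\pi_c(\mathbf l(w_0\cdots w_{N-1})): N\ge 0,\ w_N=a\}}\quad(a\in\{2,3,4\}),\qquad \widetilde{\mathcal R}=\bigcup_{a\in\{2,3,4\}}\widetilde{\mathcal R}(a).$$ Then the sets $\mathcal R(a)$, $a\in\mathcal A$, are pairwise disjoint in measure, and so are the sets $\widetilde{\mathcal R}(a)$, $a\in\{2,3,4\}$. Moreover $\mathcal R(a)+\pi_c(\mathbf e_a)\subseteq\mathcal R$ for $a\in\mathcal A$ and $\widetilde{\mathcal R}(a)+\pi_c(\mathbf e_a)\subseteq\widetilde{\mathcal R}$ for $a\in\{2,3,4\}$. Hence the domain exchanges $$E(\mathbf x)=\mathbf x+\pi_c(\mathbf e_a)\ \text{ if }\mathbf x\in\mathcal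 R(a),\qquad \widetilde E(\mathbf x)=\mathbf x+\pi_c(\mathbf e_a)\ \text{ if }\mathbf x\in\widetilde{\mathcal R}(a),$$ are defined almost everywhere on $\mathcal R$ and on $\widetilde{\mathcal R}$ respectively. Furthermore $\mathcal R\subseteq\widetilde{\mathcal R}$, and $E$ is the first return map of $\widetilde E$ on $\mathcal R$: for $\lambda$-almost every $\mathbf x\in\mathcal R$ there is a least integer $n\ge1$ with $\widetilde E^{\,n}(\mathbf x)\in\mathcal R$, and $E(\mathbf x)=\widetilde E^{\,n}(\mathbf x)$ for this $n$. -/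

import Mathlib

open MeasureTheory Polynomial

/-- The alphabet `{1, 2, 3, 4, 5}`. -/
inductive Letter : Type
  | l1 | l2 | l3 | l4 | l5
  deriving DecidableEq

instance : Fintype Letter where
  elems := {.l1, .l2, .l3, .l4, .l5}
  complete a := by cases a <;> decide

namespace Rauzy

open Letter

/-! ### Words -/

/-- The substitution `σ_t : 1 ↦ 1^(t+1) 2, 2 ↦ 3, 3 ↦ 4, 4 ↦ 1^t 5, 5 ↦ 1`. -/
def sigma (t : ℕ) : Letter → List Letter
  | l1 => List.replicate (t + 1) l1 ++ [l2]
  | l2 => [l3]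
  | l3 => [l4]
  | l4 => List.replicate t l1 ++ [l5]
  | l5 => [l1]

/-- The morphism `χ : 1 ↦ 34, 5 ↦ 32`, with `2, 3, 4` fixed. -/
def chi : Letter → List Letter
  | l1 => [l3, l4]
  | l2 => [l2]
  | l3 => [l3]
  | l4 => [l4]
  | l5 => [l3, l2]

/-- The prefix `u_0 ⋯ u_{n-1}` of an infinite word. -/
def pref (u : ℕ → Letter) (n : ℕ) : List Letter := (List.range n).map u

/-- The image `τ(u)` of the infinite word `u` under a morphism `τ` that sends letters to non-empty
words: its letter of index `n` is read off from `τ(u_0 ⋯ u_n)`, a word of length at least `n + 1`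
(so the default letter is never used). -/
def applyMorphism (τ : Letter → List Letter) (u : ℕ → Letter) : ℕ → Letter :=
  fun n => ((pref u (n + 1)).flatMap τ).getD n l1

/-- `u` is a fixed point of the substitution `σ_t`. -/
def IsFixedWord (t : ℕ) (u : ℕ → Letter) : Prop := applyMorphism (sigma t) u = u

/-! ### Representation space -/

/-- The space `ℝ⁵`, with coordinates indexed by the letters. -/
abbrev V : Type := EuclideanSpace ℝ Letter

/-- The canonical basis vector `e_a`. -/
noncomputable def e (a : Letter) : V := EuclideanSpace.single a 1

/-- The abelianization `l(w_0 ⋯ w_k) = e_{w_0} + ⋯ + e_{w_k}`. -/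
noncomputable def abel (w : List Letter) : V := (w.map e).sum

/-- The incidence matrix: the entry `(b, a)` is the number of occurrences of `b` in `σ_t(a)`. -/
def incidence (t : ℕ) : Matrix Letter Letter ℝ := fun b a => ((sigma t a).count b : ℝ)

/-- The incidence matrix as an endomorphism of `ℝ⁵`. -/
noncomputable def M (t : ℕ) : V →ₗ[ℝ] V := Matrix.toEuclideanLin (incidence t)

/-- The Pisot polynomial `f = x³ - t x² - (t+1) x - 1`. -/
noncomputable def pisotPoly (t : ℕ) : ℝ[X] := X ^ 3 - C (t : ℝ) * X ^ 2 - C ((t : ℝ) + 1) * X - 1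

/-- The Pisot number `β`, the largest real root of the Pisot polynomial. -/
noncomputable def pisot (t : ℕ) : ℝ := sSup {x : ℝ | (pisotPoly t).IsRoot x}

/-- The expanding line, the eigenspace of `β`. -/
noncomputable def Ke (t : ℕ) : Submodule ℝ V := LinearMap.ker (aeval (M t) (X - C (pisot t)))

/-- The contracting plane, the sum of the eigenspaces of the conjugates of `β` other than `β`
(as a real subspace): the kernel of `(f / (x - β))(M)`. -/
noncomputable def Kc (t : ℕ) : Submodule ℝ V :=
  LinearMap.ker (aeval (M t) (pisotPoly t /ₘ (X - C (pisot t))))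

/-- The neutral space `f(M) ℝ⁵`. -/
noncomputable def Kn (t : ℕ) : Submodule ℝ V := LinearMap.range (aeval (M t) (pisotPoly t))

/-- Every `σ_t` has a fixed point. -/
theorem exists_isFixedWord (t : ℕ) : ∃ u, IsFixedWord t u := by
  let W : ℕ → List Letter := fun n => (fun l => l.flatMap (sigma t))^[n] [l1]
  have hW0 : W 0 = [l1] := rfl
  have hW : ∀ n, W (n + 1) = (W n).flatMap (sigma t) := fun n =>
    Function.iterate_succ_apply' _ _ _
  have hmono : ∀ l l' : List Letter, l <+: l' → l.flatMap (sigma t) <+: l'.flatMap (sigma t) := by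
    rintro l l' ⟨s, rfl⟩
    simp
  have hp : ∀ n, W n <+: W (n + 1) := by
    intro n
    induction n with
    | zero => rw [hW, hW0]; simp [sigma, List.replicate_succ]
    | succ n ih => rw [hW (n + 1)]; nth_rewrite 1 [hW n]; exact hmono _ _ ih
  have hpos : ∀ a, 1 ≤ (sigma t a).length := by intro a; cases a <;> simp [sigma]
  have hle : ∀ l : List Letter, l.length ≤ (l.flatMap (sigma t)).length := by
    intro l
    induction l with
    | nil => simp
    | cons a l ih => simp only [List.flatMap_cons, List.length_append, List.length_cons]
                     have := hpos a; omega
  have hlen : ∀ n, n + 1 ≤ (W n).length := by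
    intro n
    have key : ∀ n, ∃ s, W n = l1 :: s ∧ n ≤ s.length := by
      intro n
      induction n with
      | zero => exact ⟨[], rfl, le_rfl⟩
      | succ n ih =>
        obtain ⟨s, hs, hn⟩ := ih
        refine ⟨List.replicate t l1 ++ [l2] ++ s.flatMap (sigma t), ?_, ?_⟩
        · rw [hW, hs]; simp [sigma, List.replicate_succ]
        · have := hle s
          simp only [List.length_append, List.length_replicate, List.length_singleton]; omega
    obtain ⟨s, hs, hn⟩ := key n
    rw [hs]; simpa using hn
  have hmn : ∀ m n, m ≤ n → W m <+: W n := by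
    intro m n h
    induction h with
    | refl => exact List.prefix_rfl
    | step _ ih => exact ih.trans (hp _)
  let u : ℕ → Letter := fun k => (W k).getD k l1
  have hget : ∀ (l l' : List Letter) k, l <+: l' → k < l.length → l.getD k l1 = l'.getD k l1 := by
    rintro l l' k ⟨s, rfl⟩ h
    simp [List.getElem?_append_left h]
  have hpre : ∀ n, pref u (n + 1) <+: W n := by
    intro n
    have : pref u (n + 1) = (W n).take (n + 1) := by
      apply List.ext_getElem
      · have := hlen n
        simp [pref]; omega
      · intro i h1 h2
        have hi : i ≤ n := by simp [pref] at h1; omega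
        have h3 := hget (W i) (W n) i (hmn i n hi) (hlen i)
        have h4 : i < (W n).length := lt_of_lt_of_le (by omega) (hlen n)
        simp only [pref, List.getElem_map, List.getElem_range, List.getElem_take]
        change (W i).getD i l1 = _
        rw [h3]; simp [h4]
    rw [this]; exact List.take_prefix _ _
  refine ⟨u, funext fun n => ?_⟩
  have h1 := hmono _ _ (hpre n)
  rw [← hW] at h1
  have h2 : n < ((pref u (n + 1)).flatMap (sigma t)).length :=
    lt_of_lt_of_le (by simp [pref]) (hle _)
  change List.getD _ _ _ = (W n).getD n l1
  rw [hget _ _ n h1 h2]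
  exact (hget _ _ n (hp n) (hlen n)).symm

/-- The Pisot number is a root of its polynomial, and `β > 1`. -/
theorem pisot_spec (t : ℕ) : 1 < pisot t ∧ (pisotPoly t).IsRoot (pisot t) := by
  have hev : ∀ x : ℝ, (pisotPoly t).eval x = x ^ 3 - t * x ^ 2 - (t + 1) * x - 1 := by
    intro x; simp [pisotPoly]
  have ht : (0 : ℝ) ≤ t := Nat.cast_nonneg t
  have hne : pisotPoly t ≠ 0 := by
    intro h
    have := hev 0
    rw [h] at this; norm_num at this
  have hfin : {x : ℝ | (pisotPoly t).IsRoot x}.Finite := Polynomial.finite_setOfPred_isRoot hne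
  obtain ⟨x, hx, hx0⟩ : ∃ x ∈ Set.Ioo (1 : ℝ) (t + 2), (pisotPoly t).eval x = 0 := by
    have hc : ContinuousOn (fun x => (pisotPoly t).eval x) (Set.Icc 1 ((t : ℝ) + 2)) :=
      (pisotPoly t).continuous.continuousOn
    refine intermediate_value_Ioo (by linarith) hc ⟨?_, ?_⟩
    · simp only [hev]; nlinarith
    · simp only [hev]; nlinarith
  have hmem : x ∈ {x : ℝ | (pisotPoly t).IsRoot x} := hx0
  exact ⟨hx.1.trans_le (le_csSup hfin.bddAbove hmem), Set.Nonempty.csSup_mem ⟨x, hmem⟩ hfin⟩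

theorem sum_letter {α : Type*} [AddCommMonoid α] (f : Letter → α) :
    ∑ a, f a = f l1 + f l2 + f l3 + f l4 + f l5 := by
  have : (Finset.univ : Finset Letter) = {l1, l2, l3, l4, l5} := rfl
  rw [this]
  simp [add_assoc]

theorem M_apply (t : ℕ) (x : V) (b : Letter) :
    M t x b = ∑ a, ((sigma t a).count b : ℝ) * x a := rfl

theorem M_l1 (t : ℕ) (x : V) : M t x l1 = (t + 1) * x l1 + t * x l4 + x l5 := by
  simp [M_apply, sum_letter, sigma]

theorem M_l2 (t : ℕ) (x : V) : M t x l2 = x l1 := by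
  simp [M_apply, sum_letter, sigma, List.count_replicate]

theorem M_l3 (t : ℕ) (x : V) : M t x l3 = x l2 := by
  simp [M_apply, sum_letter, sigma, List.count_replicate]

theorem M_l4 (t : ℕ) (x : V) : M t x l4 = x l3 := by
  simp [M_apply, sum_letter, sigma, List.count_replicate]

theorem M_l5 (t : ℕ) (x : V) : M t x l5 = x l4 := by
  simp [M_apply, sum_letter, sigma, List.count_replicate]

/-- The Cayley-Hamilton relation `f(M) g(M) = 0` with the neutral polynomial `g = x² - x + 1`. -/
theorem aeval_M (t : ℕ) : aeval (M t) (pisotPoly t * (X ^ 2 - X + 1)) = 0 := by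
  have h : pisotPoly t * (X ^ 2 - X + 1) =
      X ^ 5 - C ((t : ℝ) + 1) * X ^ 4 - C (t : ℝ) * X - 1 := by
    simp only [pisotPoly, C_add, C_1]; ring
  rw [h]
  ext x b
  simp only [map_sub, map_mul, aeval_X, aeval_C, map_one, LinearMap.sub_apply,
    Module.End.mul_apply, Module.algebraMap_end_apply, pow_succ, pow_zero, Module.End.one_apply,
    one_mul, PiLp.sub_apply, PiLp.smul_apply, LinearMap.zero_apply, PiLp.zero_apply, smul_eq_mul]
  cases b <;> simp only [M_l1, M_l2, M_l3, M_l4, M_l5] <;> ring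

/-- The decomposition of `ℝ⁵` into the contracting plane and the other invariant subspaces. -/
theorem isCompl_Kc (t : ℕ) : IsCompl (Kc t) (Ke t ⊔ Kn t) := by
  obtain ⟨h1, hroot⟩ := pisot_spec t
  have ht : (0 : ℝ) ≤ t := Nat.cast_nonneg t
  set β := pisot t with hβ
  set f := pisotPoly t with hf
  set q := f /ₘ (X - C β) with hq
  have hfq : (X - C β) * q = f := mul_divByMonic_eq_iff_isRoot.2 hroot
  have hfβ : β ^ 3 - t * β ^ 2 - (t + 1) * β - 1 = 0 := by
    have h := hroot.eq_zero
    simpa [hf, pisotPoly] using h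
  have hcop : ∀ p : ℝ[X], p.eval β ≠ 0 → IsCoprime (X - C β) p := fun p hp =>
    (irreducible_X_sub_C β).coprime_iff_not_dvd.2 fun h => hp (dvd_iff_isRoot.1 h)
  have hfg : IsCoprime f (X ^ 2 - X + 1) := by
    have hN : (3 * (t : ℝ) ^ 2 + 3 * t + 7) ≠ 0 := by positivity
    refine ⟨C (3 * (t : ℝ) ^ 2 + 3 * t + 7)⁻¹ * ((2 * C (t : ℝ) + 1) * X - C (t : ℝ) - 3),
      C (3 * (t : ℝ) ^ 2 + 3 * t + 7)⁻¹ * ((2 * C (t : ℝ) + 1) ^ 2 -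
        (X + 1 - C (t : ℝ)) * ((2 * C (t : ℝ) + 1) * X - C (t : ℝ) - 3)), ?_⟩
    have : (C (3 * (t : ℝ) ^ 2 + 3 * t + 7)⁻¹ : ℝ[X]) * C (3 * (t : ℝ) ^ 2 + 3 * t + 7) = 1 := by
      rw [← C_mul, inv_mul_cancel₀ hN, C_1]
    refine Eq.trans ?_ this
    have e3 : (C 3 : ℝ[X]) = 3 := rfl
    have e7 : (C 7 : ℝ[X]) = 7 := rfl
    have e : (C (3 * (t : ℝ) ^ 2 + 3 * t + 7) : ℝ[X]) = 3 * C (t : ℝ) ^ 2 + 3 * C (t : ℝ) + 7 := by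
      rw [C_add, C_add, C_mul, C_mul, C_pow, e3, e7]
    rw [e, hf, pisotPoly, C_add, C_1]
    ring
  have hqg : IsCoprime q (X ^ 2 - X + 1) := by
    rw [← hfq] at hfg; exact hfg.of_mul_left_right
  have hqβ : q.eval β ≠ 0 := by
    have hd : (derivative f).eval β = q.eval β := by
      rw [← hfq]; simp
    rw [← hd]
    have : (derivative f).eval β = 3 * β ^ 2 - 2 * t * β - (t + 1) := by
      simp [hf, pisotPoly]; ring
    rw [this]
    intro h0
    nlinarith
  have hβg : IsCoprime (X - C β) (X ^ 2 - X + 1) := hcop _ (by simp; nlinarith)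
  have hqβg : IsCoprime q ((X - C β) * (X ^ 2 - X + 1)) :=
    IsCoprime.mul_right (hcop q hqβ).symm hqg
  have hCH := aeval_M t
  have hKn : Kn t = LinearMap.ker (aeval (M t) (X ^ 2 - X + 1 : ℝ[X])) := by
    apply le_antisymm
    · rintro _ ⟨y, rfl⟩
      rw [LinearMap.mem_ker, ← Module.End.mul_apply, ← map_mul, mul_comm, hCH,
        LinearMap.zero_apply]
    · intro x hx
      obtain ⟨a, b, hab⟩ := hfg
      refine ⟨aeval (M t) a x, ?_⟩
      rw [LinearMap.mem_ker] at hx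
      have h2 : aeval (M t) (a * f + b * (X ^ 2 - X + 1)) x = x := by
        rw [hab, map_one, Module.End.one_apply]
      rw [map_add, LinearMap.add_apply, map_mul (aeval (M t)) b, Module.End.mul_apply, hx, map_zero,
        add_zero, mul_comm, map_mul, Module.End.mul_apply] at h2
      exact h2
  have hsum : Ke t ⊔ Kn t = LinearMap.ker (aeval (M t) ((X - C β) * (X ^ 2 - X + 1))) := by
    rw [hKn, Ke, sup_ker_aeval_eq_ker_aeval_mul_of_coprime _ hβg]
  rw [hsum]
  refine ⟨disjoint_ker_aeval_of_isCoprime _ hqβg, ?_⟩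
  rw [codisjoint_iff]
  change LinearMap.ker (aeval (M t) q) ⊔ _ = _
  rw [sup_ker_aeval_eq_ker_aeval_mul_of_coprime _ hqβg]
  have : q * ((X - C β) * (X ^ 2 - X + 1)) = f * (X ^ 2 - X + 1) := by rw [← hfq]; ring
  rw [this, hCH, LinearMap.ker_zero]

/-- The projection `π_c` of `ℝ⁵` onto the contracting plane, along the sum of the expanding line
and the neutral space. -/
noncomputable def piC (t : ℕ) : V →ₗ[ℝ] Kc t := (Kc t).projectionOnto _ (isCompl_Kc t)

/-- The Lebesgue measure on the contracting plane. -/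
noncomputable def lebesgue (t : ℕ) : Measure (Kc t) := (stdOrthonormalBasis ℝ (Kc t)).toBasis.addHaar

/-! ### Rauzy fractals and domain exchanges -/

/-- The subtile with label `a` of the stepped line of the infinite word `w`: the closure of
`{π_c(l(w_0 ⋯ w_{N-1})) : N ∈ ℕ, w_N = a}`. It is empty if `a` does not occur in `w`. -/
def subtile (t : ℕ) (w : ℕ → Letter) (a : Letter) : Set (Kc t) :=
  closure {x | ∃ N : ℕ, w N = a ∧ x = piC t (abel (pref w N))}

/-- The union of the subtiles of the stepped line of `w`. -/
def fractal (t : ℕ) (w : ℕ → Letter) : Set (Kc t) := ⋃ a, subtile t w a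

open Classical in
/-- The domain exchange `x ↦ x + π_c(e_a)` if `x` lies in the subtile with label `a`. The points
that lie in no subtile or in several of them are left fixed; the map is meaningful almost everywhere
on the fractal as soon as the subtiles are pairwise disjoint in measure. -/
noncomputable def exchange (t : ℕ) (w : ℕ → Letter) (x : Kc t) : Kc t :=
  if h : ∃! a, x ∈ subtile t w a then x + piC t (e h.choose) else x

/-- The domain exchange of `w` is well defined almost everywhere: the subtiles are pairwise
disjoint in measure, and the translated subtiles stay in the fractal. -/
def ExchangeWellDefined (t : ℕ) (w : ℕ → Letter) : Prop :=
  (∀ a b, a ≠ b → lebesgue t (subtile t w a ∩ subtile t w b) = 0) ∧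
  ∀ a, ∀ x ∈ subtile t w a, x + piC t (e a) ∈ fractal t w

/-- `E` is, almost everywhere on `A`, the first return map of `T` on `A`: almost every `x ∈ A`
has a least `n ≥ 1` with `T^n x ∈ A`, and `E x = T^n x` for this `n`. -/
def IsFirstReturn {X : Type*} [MeasurableSpace X] (μ : Measure X) (T : X → X) (A : Set X)
    (E : X → X) : Prop :=
  ∀ᵐ x ∂μ, x ∈ A → ∃ n, 1 ≤ n ∧ T^[n] x ∈ A ∧ (∀ k, 1 ≤ k → k < n → T^[k] x ∉ A) ∧ E x = T^[n] x

end Rauzy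

namespace Rauzy

open Letter

/-! ### The contracting plane -/

/-! On the contracting plane, `M` acts with determinant `1/β`, and some power of it halves norms.
Since `u = σ(u)`, each tile `R(c)` is the union of the images of tiles `R(b)`, one for each
occurrence of `c` in some `σ(b)` (`subtile_applyMorphism`). Weighting areas by a positive left
`β`-eigenvector of `M` gives both sides of the subadditivity inequality the same finite sum. No area
is lost, so distinct pieces of one tile overlap in a null set (`lebesgue_piece_inter_piece`).

Other overlaps `R(a) ∩ (R(b) + x)` are reduced to this case by applying `M` and choosing one
position in `σ(a)` and one in `σ(b)`. The goal is to reach two distinct pieces of the same tile. For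
`x = 0`, following first letters suffices, because every letter leads to `1`. For `x = π_c(e_3)` and
`b ∈ {1, 5}`, the shifts run through `e_3, e_4, e_5, 0`, so `R(b) + π_c(e_3)` meets `R` in a null
set.

Modulo the neutral space, `e_1 = e_3 + e_4` and `e_5 = e_3 + e_2`, so `χ` preserves projected
abelianizations. The fractal of `χ(u)` is therefore `R` together with `R(1) + π_c(e_3)` and `R(5) +
π_c(e_3)`, both outside `R` up to null sets. A point of `R(1)` or `R(5)` makes one step by
`π_c(e_3)` out of `R` and a second step back; the other tiles return at once. -/

theorem pisot_root (t : ℕ) :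
    pisot t ^ 3 - t * pisot t ^ 2 - (t + 1) * pisot t - 1 = 0 := by
  have h := (pisot_spec t).2.eq_zero
  simpa [pisotPoly] using h

theorem pisot_pos (t : ℕ) : 0 < pisot t := zero_lt_one.trans (pisot_spec t).1

theorem pisot_mul_eq_inv (t : ℕ) : pisot t * (pisot t - t - 1) = (pisot t + 1)⁻¹ := by
  have h0 := pisot_pos t
  rw [eq_comm, inv_eq_of_mul_eq_one_right]
  linear_combination pisot_root t

theorem one_lt_pisot_sub (t : ℕ) : 1 < pisot t - t := by
  have h0 := pisot_pos t
  have h : 0 < pisot t * (pisot t - t - 1) := by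
    rw [pisot_mul_eq_inv]; positivity
  have := (pos_iff_pos_of_mul_pos h).1 h0
  linarith

/-- Together with `one_lt_pisot_sub`, this is the stability condition that puts both roots of `x² +
(β - t) x + 1/β` inside the unit disc. -/
theorem pisot_sub_lt (t : ℕ) : pisot t - t < 1 + (pisot t)⁻¹ := by
  have h0 := pisot_pos t
  have h : pisot t * (pisot t - t - 1) < pisot t * (pisot t)⁻¹ := by
    rw [pisot_mul_eq_inv, mul_inv_cancel₀ h0.ne']
    exact inv_lt_one_of_one_lt₀ (by linarith)
  have := lt_of_mul_lt_mul_left h h0.le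
  linarith

theorem pisotPoly_divByMonic (t : ℕ) :
    pisotPoly t /ₘ (X - C (pisot t)) = X ^ 2 + C (pisot t - t) * X + C (pisot t)⁻¹ := by
  have h0 := (pisot_pos t).ne'
  refine mul_left_cancel₀ (X_sub_C_ne_zero (pisot t)) ?_
  rw [mul_divByMonic_eq_iff_isRoot.2 (pisot_spec t).2, pisotPoly]
  have e1 : C (pisot t) * C (pisot t)⁻¹ = 1 := by rw [← C_mul, mul_inv_cancel₀ h0, C_1]
  have e2 : C (pisot t)⁻¹ =
      C (pisot t) * C (pisot t) - C (t : ℝ) * C (pisot t) - C (t : ℝ) - 1 := by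
    rw [← C_1, ← C_mul, ← C_mul, ← C_sub, ← C_sub, ← C_sub]
    congr 1
    rw [inv_eq_of_mul_eq_one_right]
    linear_combination pisot_root t
  rw [C_add, C_1, C_sub]
  linear_combination (-X) * e2 + e1

theorem mem_Kc_iff {t : ℕ} {x : V} :
    x ∈ Kc t ↔ M t (M t x) + (pisot t - t) • M t x + (pisot t)⁻¹ • x = 0 := by
  rw [Kc, pisotPoly_divByMonic, LinearMap.mem_ker]
  simp only [map_add, map_mul, aeval_X, aeval_C, LinearMap.add_apply,
    Module.End.mul_apply, Module.algebraMap_end_apply, pow_two]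

theorem M_aeval (t : ℕ) (p : ℝ[X]) (x : V) : M t (aeval (M t) p x) = aeval (M t) p (M t x) := by
  have h : aeval (M t) (X * p) = aeval (M t) (p * X) := by rw [mul_comm]
  simpa using LinearMap.congr_fun h x

theorem M_mem_Kc {t : ℕ} {x : V} (hx : x ∈ Kc t) : M t x ∈ Kc t := by
  rw [Kc, LinearMap.mem_ker] at hx ⊢
  rw [← M_aeval, hx, map_zero]

theorem M_mem_sup {t : ℕ} {x : V} (hx : x ∈ Ke t ⊔ Kn t) : M t x ∈ Ke t ⊔ Kn t := by
  obtain ⟨y, hy, z, ⟨w, rfl⟩, rfl⟩ := Submodule.mem_sup.1 hx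
  rw [map_add]
  refine Submodule.add_mem_sup ?_ ⟨M t w, (M_aeval t _ w).symm⟩
  rw [Ke, LinearMap.mem_ker] at hy ⊢
  rw [← M_aeval, hy, map_zero]

/-- The action of the incidence matrix on the contracting plane. -/
noncomputable def contraction (t : ℕ) : Kc t →ₗ[ℝ] Kc t :=
  (M t).restrict fun _ => M_mem_Kc

theorem contraction_contraction (t : ℕ) (x : Kc t) :
    contraction t (contraction t x) =
      -(pisot t - t) • contraction t x - (pisot t)⁻¹ • x := by
  have h := mem_Kc_iff.1 x.2
  ext1
  have : M t (M t x) = -(pisot t - t) • M t x - (pisot t)⁻¹ • (x : V) := by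
    rw [eq_comm, ← sub_eq_zero, ← neg_eq_zero, ← h, neg_smul]; abel
  exact this

theorem contraction_piC (t : ℕ) (x : V) : contraction t (piC t x) = piC t (M t x) := by
  obtain ⟨y, hy, z, hz, rfl⟩ :=
    Submodule.mem_sup.1 ((isCompl_Kc t).sup_eq_top ▸ Submodule.mem_top : x ∈ Kc t ⊔ (Ke t ⊔ Kn t))
  simp only [map_add, piC]
  rw [Submodule.projectionOnto_apply_of_mem_left _ hy,
    Submodule.projectionOnto_apply_of_mem_left _ (M_mem_Kc hy),
    Submodule.projectionOnto_apply_of_mem_right _ hz,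
    Submodule.projectionOnto_apply_of_mem_right _ (M_mem_sup hz), map_zero]
  rfl

/-- The projection of the abelianization of a word to the contracting plane. -/
noncomputable def wordVec (t : ℕ) (w : List Letter) : Kc t := piC t (abel w)

/-- The projection of a basis vector to the contracting plane. -/
noncomputable def vec (t : ℕ) (a : Letter) : Kc t := piC t (e a)

theorem wordVec_nil (t : ℕ) : wordVec t [] = 0 := by simp [wordVec, abel]

theorem wordVec_cons (t : ℕ) (a : Letter) (w : List Letter) :
    wordVec t (a :: w) = vec t a + wordVec t w := by simp [wordVec, vec, abel]

theorem wordVec_append (t : ℕ) (w w' : List Letter) :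
    wordVec t (w ++ w') = wordVec t w + wordVec t w' := by simp [wordVec, abel]

theorem wordVec_replicate (t n : ℕ) (a : Letter) :
    wordVec t (List.replicate n a) = (n : ℝ) • vec t a := by
  simp [wordVec, vec, abel, Nat.cast_smul_eq_nsmul]

theorem wordVec_flatMap (t : ℕ) (τ : Letter → List Letter) (S : Kc t →ₗ[ℝ] Kc t)
    (hS : ∀ b, S (vec t b) = wordVec t (τ b)) (w : List Letter) :
    wordVec t (w.flatMap τ) = S (wordVec t w) := by
  induction w with
  | nil => simp [wordVec_nil]
  | cons a w ih => rw [List.flatMap_cons, wordVec_append, wordVec_cons, map_add, ih, hS]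

theorem abel_apply (w : List Letter) (b : Letter) : abel w b = (w.count b : ℝ) := by
  induction w with
  | nil => simp [abel]
  | cons a w ih =>
    have : abel (a :: w) = e a + abel w := by simp [abel]
    rw [this, PiLp.add_apply, ih, List.count_cons, e, PiLp.single_apply]
    rcases eq_or_ne a b with rfl | h
    · simp [add_comm]
    · simp [h, h.symm]

theorem M_e (t : ℕ) (a : Letter) : M t (e a) = abel (sigma t a) := by
  ext b
  rw [M_apply, abel_apply, Finset.sum_eq_single a] <;> simp +contextual [e]

theorem contraction_vec (t : ℕ) (a : Letter) :
    contraction t (vec t a) = wordVec t (sigma t a) := by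
  rw [vec, contraction_piC, M_e, wordVec]

/-! ### Relations between the projected basis vectors -/

/-- The projection kills `f(M) ℝ⁵`. This yields the identities that allow `χ` to split the letters
`1` and `5`. -/
theorem vec_add_eq (t : ℕ) {a b c d : Letter}
    (h : aeval (M t) (pisotPoly t) (e d) = e a + e b - e c) :
    vec t a + vec t b = vec t c := by
  have : e a + e b - e c ∈ Ke t ⊔ Kn t := Submodule.mem_sup_right ⟨e d, h⟩
  rw [← Submodule.projectionOnto_apply_eq_zero_iff (isCompl_Kc t)] at this
  change piC t _ = 0 at this
  rw [map_sub, map_add, sub_eq_zero] at this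
  exact this

theorem aeval_pisotPoly_apply (t : ℕ) (x : V) : aeval (M t) (pisotPoly t) x =
    M t (M t (M t x)) - (t : ℝ) • M t (M t x) - ((t : ℝ) + 1) • M t x - x := by
  simp only [pisotPoly, map_sub, map_mul, aeval_X, aeval_C, map_one, LinearMap.sub_apply,
    Module.End.mul_apply, Module.algebraMap_end_apply, pow_succ, pow_zero, Module.End.one_apply,
    one_mul]

theorem vec_l3_add_vec_l4 (t : ℕ) : vec t l3 + vec t l4 = vec t l1 := by
  refine vec_add_eq t (d := l1) ?_
  rw [aeval_pisotPoly_apply]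
  ext b
  cases b <;> simp [M_l1, M_l2, M_l3, M_l4, M_l5, e] <;> ring

theorem vec_l3_add_vec_l2 (t : ℕ) : vec t l3 + vec t l2 = vec t l5 := by
  refine vec_add_eq t (d := l5) ?_
  rw [aeval_pisotPoly_apply]
  ext b
  cases b <;> simp [M_l1, M_l2, M_l3, M_l4, M_l5, e] <;> ring

theorem contraction_vec_l1 (t : ℕ) :
    contraction t (vec t l1) = ((t : ℝ) + 1) • vec t l1 + vec t l2 := by
  rw [contraction_vec]
  simp [sigma, wordVec_append, wordVec_replicate, wordVec_cons, wordVec_nil]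

theorem contraction_vec_l2 (t : ℕ) : contraction t (vec t l2) = vec t l3 := by
  rw [contraction_vec]; simp [sigma, wordVec_cons, wordVec_nil]

theorem contraction_vec_l3 (t : ℕ) : contraction t (vec t l3) = vec t l4 := by
  rw [contraction_vec]; simp [sigma, wordVec_cons, wordVec_nil]

theorem contraction_vec_l4 (t : ℕ) :
    contraction t (vec t l4) = (t : ℝ) • vec t l1 + vec t l5 := by
  rw [contraction_vec]
  simp [sigma, wordVec_append, wordVec_replicate, wordVec_cons, wordVec_nil]

theorem contraction_vec_l5 (t : ℕ) : contraction t (vec t l5) = vec t l1 := by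
  rw [contraction_vec]; simp [sigma, wordVec_cons, wordVec_nil]

theorem linearIndependent_vec (t : ℕ) : LinearIndependent ℝ ![vec t l5, vec t l1] := by
  rw [LinearIndependent.pair_iff]
  intro x y h
  have hmem : x • e l5 + y • e l1 ∈ Ke t ⊔ Kn t := by
    rw [← Submodule.projectionOnto_apply_eq_zero_iff (isCompl_Kc t)]
    change piC t _ = 0
    rw [map_add, map_smul, map_smul]
    exact h
  have hle : Ke t ⊔ Kn t ≤
      LinearMap.ker (aeval (M t) ((X - C (pisot t)) * (X ^ 2 - X + 1))) := by
    refine sup_le (fun z hz => ?_) ?_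
    · rw [Ke, LinearMap.mem_ker] at hz
      rw [LinearMap.mem_ker, mul_comm, map_mul, Module.End.mul_apply, hz, map_zero]
    · rintro _ ⟨z, rfl⟩
      rw [LinearMap.mem_ker, map_mul, Module.End.mul_apply, ← Module.End.mul_apply _ _ z, ← map_mul,
        mul_comm _ (pisotPoly t), aeval_M, LinearMap.zero_apply, map_zero]
  have h0 := LinearMap.mem_ker.1 (hle hmem)
  -- Only `M³ e_1` contributes to the coordinate `4`, which forces `y = 0`; then only `M³ e_5`
  -- contributes to the coordinate `3`.
  have h4 := congrArg (fun z : V => z l4) h0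
  have h3 := congrArg (fun z : V => z l3) h0
  simp [pow_two, M_l1, M_l2, M_l3, M_l4, e] at h3 h4
  subst h4
  simpa using h3

theorem span_vec (t : ℕ) : ⊤ ≤ Submodule.span ℝ (Set.range ![vec t l5, vec t l1]) := by
  set S := Submodule.span ℝ (Set.range ![vec t l5, vec t l1]) with hS
  have h5 : vec t l5 ∈ S := Submodule.subset_span ⟨0, rfl⟩
  have h1 : vec t l1 ∈ S := Submodule.subset_span ⟨1, rfl⟩
  have hinv : ∀ x ∈ S, contraction t x ∈ S := by
    intro x hx
    refine (Submodule.span_le.2 ?_ : S ≤ S.comap (contraction t)) hx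
    rintro _ ⟨i, rfl⟩
    fin_cases i
    · change contraction t (vec t l5) ∈ S
      rwa [contraction_vec_l5]
    · change contraction t (vec t l1) ∈ S
      rw [← contraction_vec_l5, contraction_contraction, contraction_vec_l5]
      exact S.sub_mem (S.smul_mem _ h1) (S.smul_mem _ h5)
  have h2 : vec t l2 ∈ S := by
    have : vec t l2 = contraction t (vec t l1) - ((t : ℝ) + 1) • vec t l1 := by
      rw [contraction_vec_l1, add_sub_cancel_left]
    rw [this]
    exact S.sub_mem (hinv _ h1) (S.smul_mem _ h1)
  have h3 : vec t l3 ∈ S := contraction_vec_l2 t ▸ hinv _ h2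
  have h4 : vec t l4 ∈ S := contraction_vec_l3 t ▸ hinv _ h3
  intro x _
  obtain ⟨y, rfl⟩ := Submodule.projectionOnto_surjective (isCompl_Kc t) x
  have hy : y = ∑ a, y a • e a := by
    ext b; cases b <;> simp [sum_letter, e]
  change piC t y ∈ S
  rw [hy, map_sum]
  refine S.sum_mem fun a _ => ?_
  rw [map_smul]
  refine S.smul_mem _ ?_
  cases a <;> assumption

/-- In the basis `vec t l5, vec t l1` the action is the companion matrix of `f / (x - β)`. -/
theorem det_contraction (t : ℕ) : LinearMap.det (contraction t) = (pisot t)⁻¹ := by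
  let b := Module.Basis.mk (linearIndependent_vec t) (span_vec t)
  have hb0 : b 0 = vec t l5 := by simp [b]
  have hb1 : b 1 = vec t l1 := by simp [b]
  have : contraction t = Matrix.toLin b b !![0, -(pisot t)⁻¹; 1, -(pisot t - t)] := by
    refine b.ext fun i => ?_
    rw [Matrix.toLin_self, Fin.sum_univ_two]
    fin_cases i
    · simp [hb0, hb1, contraction_vec_l5]
    · simp only [Fin.mk_one, hb1, hb0]
      rw [← contraction_vec_l5, contraction_contraction]
      simp
      abel
  rw [this, LinearMap.det_toLin, Matrix.det_fin_two]
  simp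

/-! ### Iterates of the contraction -/

/-- A non-real root has squared modulus `c`. A real root is negative, and it exceeds `-1` because
`z² + (1 + c) z + c = (z + 1)(z + c)`. -/
theorem norm_lt_one_of_quadratic {b c : ℝ} (hb : 0 < b) (hc : 0 < c) (hc1 : c < 1)
    (hbc : b < 1 + c) {z : ℂ} (hz : z ^ 2 + b * z + c = 0) : ‖z‖ < 1 := by
  have hre := congrArg Complex.re hz
  have him := congrArg Complex.im hz
  simp [pow_two] at hre him
  suffices h : z.re * z.re + z.im * z.im < 1 by
    have h2 := Complex.sq_norm z
    rw [Complex.normSq_apply] at h2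
    nlinarith [norm_nonneg z]
  have h : z.im * (2 * z.re + b) = 0 := by linear_combination him
  rcases mul_eq_zero.1 h with h | h
  · rw [h] at hre ⊢
    have h1 : z.re < 0 := by
      by_contra! h1
      nlinarith [mul_nonneg hb.le h1]
    have h2 : -1 < z.re := by
      by_contra! h2
      nlinarith [mul_pos (sub_pos.2 hbc) (neg_pos.2 h1)]
    nlinarith
  · have hb : b = -2 * z.re := by linarith
    rw [hb] at hre
    nlinarith

theorem tendsto_zero_of_recurrence {b c : ℝ} (hb : 0 < b) (hc : 0 < c) (hc1 : c < 1)
    (hbc : b < 1 + c) {s : ℕ → ℝ} (h0 : s 0 = 0) (h1 : s 1 = 1)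
    (hs : ∀ n, s (n + 2) = -b * s (n + 1) - c * s n) :
    Filter.Tendsto s Filter.atTop (nhds 0) := by
  obtain ⟨w, hw⟩ := IsAlgClosed.exists_pow_nat_eq ((b : ℂ) ^ 2 - 4 * c) (n := 2) two_pos
  set z₁ : ℂ := (-b + w) / 2 with hz₁
  set z₂ : ℂ := (-b - w) / 2 with hz₂
  have n₁ : ‖z₁‖ < 1 :=
    norm_lt_one_of_quadratic hb hc hc1 hbc (by rw [hz₁]; linear_combination hw / 4)
  have n₂ : ‖z₂‖ < 1 :=
    norm_lt_one_of_quadratic hb hc hc1 hbc (by rw [hz₂]; linear_combination hw / 4)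
  have hd : ∀ n, (s (n + 1) : ℂ) = z₁ * s n + z₂ ^ n := by
    intro n
    induction n with
    | zero => simp [h0, h1]
    | succ n ih =>
      have : (s (n + 2) : ℂ) = -b * s (n + 1) - c * s n := by rw [hs]; push_cast; ring
      rw [this, pow_succ]
      have e1 : (b : ℂ) = -z₁ - z₂ := by rw [hz₁, hz₂]; ring
      have e2 : (c : ℂ) = z₁ * z₂ := by rw [hz₁, hz₂]; linear_combination hw / 4
      rw [e1, e2]
      linear_combination z₂ * ih
  obtain ⟨ρ, hρ, hρ1⟩ := exists_between (max_lt zero_lt_one (max_lt n₁ n₂))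
  have hρ0 : 0 < ρ := (le_max_left _ _).trans_lt hρ
  have r₁ : ‖z₁‖ ≤ ρ := ((le_max_left _ _).trans (le_max_right _ _)).trans hρ.le
  have r₂ : ‖z₂‖ ≤ ρ := ((le_max_right _ _).trans (le_max_right _ _)).trans hρ.le
  -- The factor `n` covers a possible double root; the extra `ρ` on the left avoids the exponent `n
  -- - 1`.
  have hbound : ∀ n, ρ * ‖s n‖ ≤ n * ρ ^ n := by
    intro n
    induction n with
    | zero => simp [h0]
    | succ n ih =>
      have h2 : ‖s (n + 1)‖ ≤ ρ * ‖s n‖ + ρ ^ n := by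
        rw [← Complex.norm_real, hd, ← Complex.norm_real (s n)]
        refine (norm_add_le _ _).trans ?_
        rw [norm_mul, norm_pow]
        gcongr
      calc ρ * ‖s (n + 1)‖ ≤ ρ * (n * ρ ^ n + ρ ^ n) := by gcongr; exact h2.trans (by gcongr)
        _ = ((n + 1 : ℕ) : ℝ) * ρ ^ (n + 1) := by push_cast; ring
  have hlim := (tendsto_self_mul_const_pow_of_lt_one hρ0.le hρ1).mul_const ρ⁻¹
  rw [zero_mul] at hlim
  refine squeeze_zero_norm (fun n => ?_) hlim
  rw [← div_eq_mul_inv, le_div_iff₀ hρ0, mul_comm]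
  exact hbound n

/-- The solution of `s (n + 2) = -b s (n + 1) - c s n` with `s 0 = 0` and `s 1 = 1`. -/
def recSeq (b c : ℝ) : ℕ → ℝ
  | 0 => 0
  | 1 => 1
  | n + 2 => -b * recSeq b c (n + 1) - c * recSeq b c n

theorem contraction_iterate (t n : ℕ) (x : Kc t) :
    (contraction t)^[n] x =
      recSeq (pisot t - t) (pisot t)⁻¹ n • contraction t x +
        (recSeq (pisot t - t) (pisot t)⁻¹ (n + 1) +
          (pisot t - t) * recSeq (pisot t - t) (pisot t)⁻¹ n) • x := by
  induction n with
  | zero => simp [recSeq]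
  | succ n ih =>
    rw [Function.iterate_succ_apply', ih, map_add, map_smul, map_smul, contraction_contraction,
      recSeq]
    module

/-- Iterates are combinations of `contraction t` and the identity with coefficients tending to `0`.
A power is needed because small eigenvalues do not bound the norm of the map itself. -/
theorem exists_iterate_norm_le (t : ℕ) :
    ∃ k, ∀ x : Kc t, ‖(contraction t)^[k] x‖ ≤ 1 / 2 * ‖x‖ := by
  set b := pisot t - t
  set c := (pisot t)⁻¹
  have h := tendsto_zero_of_recurrence (zero_lt_one.trans (one_lt_pisot_sub t))
    (inv_pos.2 (pisot_pos t)) (inv_lt_one_of_one_lt₀ (pisot_spec t).1) (pisot_sub_lt t)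
    (s := recSeq b c) rfl rfl fun _ => rfl
  let L := LinearMap.toContinuousLinearMap (contraction t)
  have h' : Filter.Tendsto (fun n => ‖recSeq b c n‖ * ‖L‖ +
      ‖recSeq b c (n + 1) + b * recSeq b c n‖) Filter.atTop
        (nhds (‖(0 : ℝ)‖ * ‖L‖ + ‖(0 : ℝ) + b * 0‖)) :=
    (h.norm.mul_const _).add (((h.comp (Filter.tendsto_add_atTop_nat 1)).add (h.const_mul b)).norm)
  simp only [norm_zero, zero_mul, mul_zero, add_zero] at h'
  obtain ⟨k, hk⟩ := (h'.eventually_le_const (show (0 : ℝ) < 1 / 2 by norm_num)).exists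
  refine ⟨k, fun x => ?_⟩
  rw [contraction_iterate]
  refine le_trans (norm_add_le _ _) ?_
  rw [norm_smul, norm_smul]
  have hL : ‖contraction t x‖ ≤ ‖L‖ * ‖x‖ := L.le_opNorm x
  calc _ ≤ ‖recSeq b c k‖ * (‖L‖ * ‖x‖) + ‖recSeq b c (k + 1) + b * recSeq b c k‖ * ‖x‖ := by gcongr
    _ = (‖recSeq b c k‖ * ‖L‖ + ‖recSeq b c (k + 1) + b * recSeq b c k‖) * ‖x‖ := by ring
    _ ≤ _ := by gcongr

/-! ### Images of infinite words -/

theorem pref_succ (u : ℕ → Letter) (n : ℕ) : pref u (n + 1) = pref u n ++ [u n] := by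
  simp [pref, List.range_succ]

theorem length_pref (u : ℕ → Letter) (n : ℕ) : (pref u n).length = n := by simp [pref]

theorem pref_isPrefix (u : ℕ → Letter) {m n : ℕ} (h : m ≤ n) : pref u m <+: pref u n := by
  induction h with
  | refl => exact List.prefix_rfl
  | step _ ih => rw [pref_succ]; exact ih.trans (List.prefix_append _ _)

variable {τ : Letter → List Letter}

theorem length_le_length_flatMap (hτ : ∀ a, τ a ≠ []) (w : List Letter) :
    w.length ≤ (w.flatMap τ).length := by
  induction w with
  | nil => simp
  | cons a w ih =>
    have := List.length_pos_iff.2 (hτ a)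
    simp only [List.flatMap_cons, List.length_append, List.length_cons]
    omega

theorem applyMorphism_eq (hτ : ∀ a, τ a ≠ []) (u : ℕ → Letter) {m n : ℕ}
    (h : n < ((pref u m).flatMap τ).length) :
    applyMorphism τ u n = ((pref u m).flatMap τ)[n] := by
  have h' : n < ((pref u (n + 1)).flatMap τ).length :=
    (Nat.lt_succ_self n).trans_le
      ((length_pref u (n + 1)).ge.trans (length_le_length_flatMap hτ _))
  have e : applyMorphism τ u n = ((pref u (n + 1)).flatMap τ)[n] := by
    rw [applyMorphism, List.getD_eq_getElem _ _ h']
  rw [e]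
  rcases le_total m (n + 1) with hm | hm
  · obtain ⟨s, hs⟩ := pref_isPrefix u hm
    simp only [← hs, List.flatMap_append]
    rw [List.getElem_append_left h]
  · obtain ⟨s, hs⟩ := pref_isPrefix u hm
    simp only [← hs, List.flatMap_append]
    rw [List.getElem_append_left h']

theorem pref_applyMorphism (hτ : ∀ a, τ a ≠ []) (u : ℕ → Letter) {m n : ℕ}
    (h : n ≤ ((pref u m).flatMap τ).length) :
    pref (applyMorphism τ u) n = ((pref u m).flatMap τ).take n := by
  refine List.ext_getElem (by simp only [length_pref, List.length_take]; omega)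
    fun i h1 h2 => ?_
  rw [length_pref] at h1
  rw [List.getElem_take]
  simp only [pref, List.getElem_map, List.getElem_range]
  exact applyMorphism_eq hτ u (h1.trans_le h)

theorem applyMorphism_length_add (hτ : ∀ a, τ a ≠ []) (u : ℕ → Letter) (m : ℕ)
    (j : Fin (τ (u m)).length) :
    applyMorphism τ u (((pref u m).flatMap τ).length + j) = (τ (u m))[j] ∧
    pref (applyMorphism τ u) (((pref u m).flatMap τ).length + j) =
      (pref u m).flatMap τ ++ (τ (u m)).take j := by
  have e : (pref u (m + 1)).flatMap τ = (pref u m).flatMap τ ++ τ (u m) := by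
    simp [pref_succ]
  have h : ((pref u m).flatMap τ).length + j < ((pref u (m + 1)).flatMap τ).length := by
    rw [e, List.length_append]; have := j.2; omega
  constructor
  · rw [applyMorphism_eq hτ u h]
    simp only [e]
    rw [List.getElem_append_right (Nat.le_add_right _ _)]
    simp
  · rw [pref_applyMorphism hτ u h.le, e, List.take_length_add_append]

theorem exists_eq_length_add (hτ : ∀ a, τ a ≠ []) (u : ℕ → Letter) (n : ℕ) :
    ∃ m ≤ n, ∃ j : Fin (τ (u m)).length, n = ((pref u m).flatMap τ).length + j := by
  have hex : ∃ k, n < ((pref u k).flatMap τ).length :=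
    ⟨n + 1, (Nat.lt_succ_self n).trans_le
      ((length_pref u (n + 1)).ge.trans (length_le_length_flatMap hτ _))⟩
  classical
  obtain ⟨m, hm⟩ : ∃ m, Nat.find hex = m + 1 := by
    refine Nat.exists_eq_succ_of_ne_zero fun h => ?_
    have := Nat.find_spec hex
    rw [h] at this
    simp [pref] at this
  have h1 := Nat.find_spec hex
  have h2 := Nat.find_min hex (m := m) (by omega)
  rw [hm, pref_succ] at h1
  simp only [List.flatMap_append, List.flatMap_singleton, List.length_append] at h1
  have h3 := length_le_length_flatMap hτ (pref u m)
  rw [length_pref] at h3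
  exact ⟨m, by omega, ⟨n - ((pref u m).flatMap τ).length, by omega⟩, by simp only; omega⟩

/-! ### Set equations -/

/-- The positions in the images of the letters under a morphism. -/
abbrev Position (τ : Letter → List Letter) : Type := Σ b : Letter, Fin (τ b).length

/-- The letter at a position. -/
def Position.letter (i : Position τ) : Letter := (τ i.1)[i.2]

/-- The vector of the word in front of a position. -/
noncomputable def Position.vec (t : ℕ) (i : Position τ) : Kc t := wordVec t ((τ i.1).take i.2)

/-- The piece of the image tile that comes from a position. -/
def piece (t : ℕ) (u : ℕ → Letter) (S : Kc t →ₗ[ℝ] Kc t) (i : Position τ) : Set (Kc t) :=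
  (fun x => S x + i.vec t) '' subtile t u i.1

theorem continuous_affine {t : ℕ} (S : Kc t →ₗ[ℝ] Kc t) (y : Kc t) :
    Continuous fun x => S x + y :=
  (LinearMap.continuous_of_finiteDimensional S).add continuous_const

theorem isCompact_piece {t : ℕ} {u : ℕ → Letter} (hu : ∀ b, IsCompact (subtile t u b))
    (S : Kc t →ₗ[ℝ] Kc t) (i : Position τ) : IsCompact (piece t u S i) :=
  (hu _).image (continuous_affine S _)

theorem wordVec_position (hτ : ∀ a, τ a ≠ []) {t : ℕ} {S : Kc t →ₗ[ℝ] Kc t}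
    (hS : ∀ b, S (vec t b) = wordVec t (τ b)) (u : ℕ → Letter) (m : ℕ)
    (j : Fin (τ (u m)).length) :
    wordVec t (pref (applyMorphism τ u) (((pref u m).flatMap τ).length + j)) =
      S (wordVec t (pref u m)) + Position.vec (τ := τ) t ⟨u m, j⟩ := by
  rw [(applyMorphism_length_add hτ u m j).2, wordVec_append, wordVec_flatMap t τ S hS]
  rfl

/-- Each index of `τ(u)` lies in a unique block `τ(u_m)`, so its prefix vector is `S` of the prefix
vector of `u` plus a position vector. Compactness makes the finite union closed. The result serves
`σ` with `S = contraction t` and `χ` with `S = id`. -/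
theorem subtile_applyMorphism (hτ : ∀ a, τ a ≠ []) {t : ℕ} {S : Kc t →ₗ[ℝ] Kc t}
    (hS : ∀ b, S (vec t b) = wordVec t (τ b)) {u : ℕ → Letter}
    (hu : ∀ b, IsCompact (subtile t u b)) (c : Letter) :
    subtile t (applyMorphism τ u) c = ⋃ i : Position τ, ⋃ _ : i.letter = c, piece t u S i := by
  refine subset_antisymm (closure_minimal ?_ ?_) (Set.iUnion₂_subset ?_)
  · rintro _ ⟨n, hn, rfl⟩
    obtain ⟨m, -, j, rfl⟩ := exists_eq_length_add hτ u n
    refine Set.mem_iUnion₂.2 ⟨⟨u m, j⟩, (applyMorphism_length_add hτ u m j).1.symm.trans hn,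
      wordVec t (pref u m), subset_closure ⟨m, rfl, rfl⟩, ?_⟩
    exact (wordVec_position hτ hS u m j).symm
  · exact isClosed_iUnion_of_finite fun i => isClosed_iUnion_of_finite fun _ =>
      (isCompact_piece hu S i).isClosed
  · rintro i rfl
    rw [piece, Set.image_subset_iff]
    refine closure_minimal ?_ (isClosed_closure.preimage (continuous_affine S _))
    rintro _ ⟨m, hm, rfl⟩
    obtain ⟨b, j⟩ := i
    obtain rfl : u m = b := hm
    exact subset_closure ⟨_, (applyMorphism_length_add hτ u m j).1,
      (wordVec_position hτ hS u m j).symm⟩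

theorem sigma_ne_nil (t : ℕ) (a : Letter) : sigma t a ≠ [] := by cases a <;> simp [sigma]

theorem chi_ne_nil (a : Letter) : chi a ≠ [] := by cases a <;> simp [chi]

/-- Desubstituting a prefix `k` times leaves an error drawn from finitely many position vectors at
each level. -/
theorem exists_wordVec_iterate {t : ℕ} {u : ℕ → Letter} (hu : IsFixedWord t u) (k : ℕ) :
    ∃ C, ∀ n, ∃ m ≤ n,
      ‖wordVec t (pref u n) - (contraction t)^[k] (wordVec t (pref u m))‖ ≤ C := by
  induction k with
  | zero => exact ⟨0, fun n => ⟨n, le_rfl, by simp⟩⟩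
  | succ k ih =>
    obtain ⟨C, hC⟩ := ih
    obtain ⟨D, hD⟩ := (Set.finite_range fun i : Position (sigma t) =>
      ‖(contraction t ^ k) (i.vec t)‖).bddAbove
    refine ⟨C + D, fun n => ?_⟩
    obtain ⟨m, hm, h⟩ := hC n
    obtain ⟨l, hl, j, hj⟩ := exists_eq_length_add (sigma_ne_nil t) u m
    refine ⟨l, hl.trans hm, ?_⟩
    have e := wordVec_position (sigma_ne_nil t) (contraction_vec t) u l j
    rw [← hj, show applyMorphism (sigma t) u = u from hu] at e
    rw [Function.iterate_succ_apply]
    have hD' := hD ⟨⟨u l, j⟩, rfl⟩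
    dsimp only at hD'
    rw [e, ← Module.End.pow_apply, map_add, Module.End.pow_apply] at h
    refine le_trans (le_of_eq ?_) ((norm_add_le _ _).trans (add_le_add h hD'))
    congr 1
    abel

theorem isCompact_subtile {t : ℕ} {u : ℕ → Letter} (hu : IsFixedWord t u) (a : Letter) :
    IsCompact (subtile t u a) := by
  obtain ⟨k, hk⟩ := exists_iterate_norm_le t
  obtain ⟨C, hC⟩ := exists_wordVec_iterate hu k
  have key : ∀ n, ‖wordVec t (pref u n)‖ ≤ 2 * C := by
    intro n
    induction n using Nat.strong_induction_on with
    | _ n ih =>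
      obtain ⟨m, hm, h⟩ := hC n
      have h1 := hk (wordVec t (pref u m))
      have h2 := norm_le_norm_add_norm_sub' (wordVec t (pref u n))
        ((contraction t)^[k] (wordVec t (pref u m)))
      -- If `m = n`, the estimate `‖v‖ ≤ ‖v‖ / 2 + C` already gives the bound, without induction.
      rcases hm.lt_or_eq with hm | rfl
      · have := ih m hm
        linarith
      · linarith
  refine ((Metric.isBounded_closedBall (x := (0 : Kc t)) (r := 2 * C)).subset
    ?_).isCompact_closure
  rintro _ ⟨n, -, rfl⟩
  exact mem_closedBall_zero_iff.2 (key n)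

/-! ### Domain exchanges -/

theorem add_vec_mem_fractal {t : ℕ} {w : ℕ → Letter} {a : Letter} {x : Kc t}
    (hx : x ∈ subtile t w a) : x + vec t a ∈ fractal t w := by
  have hcl : IsClosed (fractal t w) := isClosed_iUnion_of_finite fun _ => isClosed_closure
  refine closure_minimal ?_ (hcl.preimage (continuous_id.add continuous_const)) hx
  rintro _ ⟨n, rfl, rfl⟩
  refine Set.mem_iUnion.2 ⟨w (n + 1), subset_closure ⟨n + 1, rfl, ?_⟩⟩
  change wordVec t (pref w n) + vec t (w n) = wordVec t (pref w (n + 1))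
  rw [pref_succ, wordVec_append, wordVec_cons, wordVec_nil, add_zero]

theorem exchange_eq {t : ℕ} {w : ℕ → Letter} {a : Letter} {x : Kc t} (hx : x ∈ subtile t w a)
    (h : ∀ b, x ∈ subtile t w b → b = a) : exchange t w x = x + vec t a := by
  have hu : ∃! a, x ∈ subtile t w a := ⟨a, hx, h⟩
  rw [exchange, dif_pos hu, h _ hu.choose_spec.1]
  rfl

/-! ### Overlaps of pieces -/

instance (t : ℕ) : (lebesgue t).IsAddHaarMeasure := by
  unfold lebesgue; infer_instance

theorem lebesgue_image_affine (t : ℕ) (y : Kc t) (s : Set (Kc t)) :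
    lebesgue t ((fun x => contraction t x + y) '' s) =
      ENNReal.ofReal (pisot t)⁻¹ * lebesgue t s := by
  have : (fun x => contraction t x + y) '' s = (fun x => x + y) '' (contraction t '' s) := by
    rw [Set.image_image]
  rw [this, Set.image_add_right, measure_preimage_add_right, Measure.addHaar_image_linearMap,
    det_contraction, abs_of_pos (inv_pos.2 (pisot_pos t))]

/-- The positive left eigenvector of the incidence matrix. -/
noncomputable def weight (t : ℕ) : Letter → ℝ
  | l1 => pisot t
  | l2 => pisot t * (pisot t - t - 1)
  | l3 => pisot t ^ 2 * (pisot t - t - 1)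
  | l4 => pisot t ^ 3 * (pisot t - t - 1)
  | l5 => 1

theorem weight_pos (t : ℕ) (a : Letter) : 0 < weight t a := by
  have h0 := pisot_pos t
  have h1 : 0 < pisot t - t - 1 := sub_pos.2 (one_lt_pisot_sub t)
  cases a <;> simp only [weight] <;> positivity

theorem sum_weight_sigma (t : ℕ) (b : Letter) :
    ∑ j : Fin (sigma t b).length, weight t (sigma t b)[j] = pisot t * weight t b := by
  have h : ∀ l : List Letter, ∑ j : Fin l.length, weight t l[j] = (l.map (weight t)).sum :=
    fun l => Fin.sum_univ_fun_getElem l (weight t)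
  rw [h]
  cases b <;> simp [sigma, weight]
  · ring
  · ring
  · ring
  · linear_combination (-(pisot t) ^ 2 + pisot t - 1) * pisot_root t

theorem measureReal_biUnion_add_inter_le {ι X : Type*} [DecidableEq ι] [MeasurableSpace X]
    (μ : Measure X) (s : Finset ι) {A : ι → Set X} (hA : ∀ i, MeasurableSet (A i))
    (hfin : ∀ i, μ (A i) ≠ ⊤) {i j : ι} (hi : i ∈ s) (hj : j ∈ s) (hij : i ≠ j) :
    μ.real (⋃ k ∈ s, A k) + μ.real (A i ∩ A j) ≤ ∑ k ∈ s, μ.real (A k) := by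
  have hj' : j ∈ s.erase i := Finset.mem_erase.2 ⟨hij.symm, hj⟩
  rw [← Finset.add_sum_erase _ _ hi, ← Finset.add_sum_erase _ _ hj', ← add_assoc,
    ← measureReal_union_add_inter (hA j) (hfin i) (hfin j)]
  have hU : ⋃ k ∈ s, A k = (A i ∪ A j) ∪ ⋃ k ∈ (s.erase i).erase j, A k := by
    rw [← Finset.insert_erase hi, ← Finset.insert_erase hj']
    simp only [Finset.mem_insert, Set.iUnion_iUnion_eq_or_left, Set.union_assoc]
    simp [hij, hij.symm]
  rw [hU]
  have h1 := measureReal_union_le (μ := μ) (A i ∪ A j) (⋃ k ∈ (s.erase i).erase j, A k)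
  have h2 := measureReal_biUnion_finset_le (μ := μ) ((s.erase i).erase j) A
  linarith

/-- An overlap of positive area would make one of the subadditivity inequalities strict, while their
sum with positive weights is an equality between finite quantities. -/
theorem lebesgue_piece_inter_piece {t : ℕ} {u : ℕ → Letter} (hu : IsFixedWord t u)
    {i j : Position (sigma t)} (hij : i ≠ j) (hl : i.letter = j.letter) :
    lebesgue t (piece t u (contraction t) i ∩ piece t u (contraction t) j) = 0 := by
  classical
  set μ := lebesgue t
  set P := piece (τ := sigma t) t u (contraction t)
  have hc := isCompact_subtile hu
  have hP : ∀ k, IsCompact (P k) := isCompact_piece hc _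
  have hfin : ∀ k, μ (P k) ≠ ⊤ := fun k => (hP k).measure_lt_top.ne
  have hm : ∀ k, MeasurableSet (P k) := fun k => (hP k).measurableSet
  have hreal : ∀ k, μ.real (P k) = (pisot t)⁻¹ * μ.real (subtile t u k.1) := fun k => by
    simp only [Measure.real, P, μ, piece, lebesgue_image_affine, ENNReal.toReal_mul]
    rw [ENNReal.toReal_ofReal (inv_pos.2 (pisot_pos t)).le]
  have hset : ∀ c, subtile t u c = ⋃ k ∈ Finset.univ.filter fun k => k.letter = c, P k := by
    intro c
    conv_lhs => rw [← show applyMorphism (sigma t) u = u from hu]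
    rw [subtile_applyMorphism (sigma_ne_nil t) (contraction_vec t) hc]
    simp [P]
  -- The overlap is charged only to the tile that contains both pieces.
  have hle : ∀ c, μ.real (subtile t u c) + (if c = i.letter then μ.real (P i ∩ P j) else 0) ≤
      ∑ k with Position.letter k = c, μ.real (P k) := by
    intro c
    split_ifs with h
    · rw [hset]
      exact measureReal_biUnion_add_inter_le μ _ hm hfin (by simp [h]) (by simp [h, hl]) hij
    · rw [hset, add_zero]
      exact measureReal_biUnion_finset_le _ _
  have hsum := Finset.sum_le_sum fun c (_ : c ∈ Finset.univ) =>
    mul_le_mul_of_nonneg_left (hle c) (weight_pos t c).le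
  -- Regrouping by source letter `b`, the eigenvector factor `β` cancels the area factor `1/β`.
  have hR : ∑ c, weight t c * ∑ k with Position.letter k = c, μ.real (P k) =
      ∑ c, weight t c * μ.real (subtile t u c) := by
    calc _ = ∑ c, ∑ k with Position.letter k = c, weight t k.letter * μ.real (P k) := by
          refine Finset.sum_congr rfl fun c _ => ?_
          rw [Finset.mul_sum]
          refine Finset.sum_congr rfl fun k hk => ?_
          rw [(Finset.mem_filter.1 hk).2]
      _ = ∑ k : Position (sigma t), weight t k.letter * μ.real (P k) :=
          Finset.sum_fiberwise _ _ _
      _ = ∑ b, ∑ l : Fin (sigma t b).length, weight t (sigma t b)[l] *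
            ((pisot t)⁻¹ * μ.real (subtile t u b)) := by
          rw [Fintype.sum_sigma]
          simp only [hreal]
          rfl
      _ = _ := by
          refine Finset.sum_congr rfl fun b _ => ?_
          rw [← Finset.sum_mul, sum_weight_sigma]
          have := (pisot_pos t).ne'
          field_simp
  rw [hR] at hsum
  simp only [mul_add, Finset.sum_add_distrib, mul_ite, mul_zero, Finset.sum_ite_eq',
    Finset.mem_univ, if_true] at hsum
  have h0 : μ.real (P i ∩ P j) ≤ 0 := by
    have := weight_pos t i.letter
    by_contra! h
    have := mul_pos this h
    linarith
  have h1 : μ (P i ∩ P j) ≠ ⊤ := ne_top_of_le_ne_top (hfin i) (measure_mono Set.inter_subset_left)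
  exact (measureReal_eq_zero_iff h1).1 (le_antisymm h0 measureReal_nonneg)

/-- The tile with label `a` meets the translate by `x` of the tile with label `b` in a null set. -/
def NullOverlap (t : ℕ) (u : ℕ → Letter) (a b : Letter) (x : Kc t) : Prop :=
  lebesgue t (subtile t u a ∩ {y | y - x ∈ subtile t u b}) = 0

theorem eq_zero_of_image_subset {t : ℕ} {y : Kc t} {s s' : Set (Kc t)}
    (h : (fun x => contraction t x + y) '' s ⊆ s') (h0 : lebesgue t s' = 0) :
    lebesgue t s = 0 := by
  have := measure_mono_null h h0
  rw [lebesgue_image_affine, mul_eq_zero] at this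
  refine this.resolve_left ?_
  simp [pisot_pos t]

theorem piece_subset {t : ℕ} {u : ℕ → Letter} (hu : IsFixedWord t u) (i : Position (sigma t)) :
    piece t u (contraction t) i ⊆ subtile t u i.letter := by
  conv_rhs => rw [← show applyMorphism (sigma t) u = u from hu]
  rw [subtile_applyMorphism (sigma_ne_nil t) (contraction_vec t) (isCompact_subtile hu)]
  exact Set.subset_iUnion₂_of_subset i rfl subset_rfl

/-- The affine map of position `i` scales area by `1/β ≠ 0` and carries the overlap into that of the
two larger tiles, so nullity pulls back. -/
theorem nullOverlap_of_positions {t : ℕ} {u : ℕ → Letter} (hu : IsFixedWord t u)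
    (i j : Position (sigma t)) (x : Kc t)
    (h : NullOverlap t u i.letter j.letter (contraction t x + i.vec t - j.vec t)) :
    NullOverlap t u i.1 j.1 x := by
  refine eq_zero_of_image_subset (y := i.vec t) ?_ h
  rintro _ ⟨y, ⟨h1, h2⟩, rfl⟩
  refine ⟨piece_subset hu i ⟨y, h1, rfl⟩, piece_subset hu j ⟨y - x, h2, ?_⟩⟩
  simp only [map_sub]
  abel

/-- Terminal case of the reduction: the overlap is carried into the intersection of two distinct
pieces of one tile. -/
theorem nullOverlap_of_coincidence {t : ℕ} {u : ℕ → Letter} (hu : IsFixedWord t u)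
    {i j : Position (sigma t)} (hij : i ≠ j) (hl : i.letter = j.letter) {x : Kc t}
    (h : contraction t x + i.vec t = j.vec t) : NullOverlap t u i.1 j.1 x := by
  refine eq_zero_of_image_subset (y := i.vec t) ?_ (lebesgue_piece_inter_piece hu hij hl)
  rintro _ ⟨y, ⟨h1, h2⟩, rfl⟩
  refine ⟨⟨y, h1, rfl⟩, ⟨y - x, h2, ?_⟩⟩
  simp only [map_sub, ← h]
  abel

/-- The first position in the image of a letter. -/
def firstPos (t : ℕ) (a : Letter) : Position (sigma t) :=
  ⟨a, 0, List.length_pos_iff.2 (sigma_ne_nil t a)⟩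

/-- The first letter of the image of a letter. -/
def firstLetter (t : ℕ) (a : Letter) : Letter := (firstPos t a).letter

theorem firstPos_vec (t : ℕ) (a : Letter) : (firstPos t a).vec t = 0 := by
  simp [firstPos, Position.vec, wordVec_nil]

theorem firstLetter_l1 (t : ℕ) : firstLetter t l1 = l1 := by
  simp [firstLetter, firstPos, Position.letter, sigma, List.replicate_succ]

/-- The longest path is `2, 3, 4, 5, 1`, which occurs for `t = 0`. -/
theorem firstLetter_iterate (t : ℕ) (a : Letter) : (firstLetter t)^[4] a = l1 := by
  have h1 : firstLetter t l1 = l1 := firstLetter_l1 t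
  have h2 : firstLetter t l2 = l3 := rfl
  have h3 : firstLetter t l3 = l4 := rfl
  have h5 : firstLetter t l5 = l1 := rfl
  have h4 : firstLetter t l4 = l1 ∨ firstLetter t l4 = l5 := by
    cases t with
    | zero => exact Or.inr rfl
    | succ t => exact Or.inl rfl
  simp only [Function.iterate_succ_apply, Function.iterate_zero_apply]
  rcases h4 with h4 | h4 <;> cases a <;> simp [h1, h2, h3, h4, h5]

theorem nullOverlap_zero {t : ℕ} {u : ℕ → Letter} (hu : IsFixedWord t u) {a b : Letter}
    (hab : a ≠ b) : NullOverlap t u a b 0 := by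
  have key : ∀ n a b, a ≠ b → (firstLetter t)^[n] a = (firstLetter t)^[n] b →
      NullOverlap t u a b 0 := by
    intro n
    induction n with
    | zero => exact fun a b hab h => absurd h hab
    | succ n ih =>
      intro a b hab h
      by_cases hf : firstLetter t a = firstLetter t b
      · refine nullOverlap_of_coincidence hu (i := firstPos t a) (j := firstPos t b) ?_ hf ?_
        · exact fun h => hab (congrArg Sigma.fst h)
        · rw [firstPos_vec, firstPos_vec, map_zero, add_zero]
      · refine nullOverlap_of_positions hu (firstPos t a) (firstPos t b) 0 ?_
        rw [firstPos_vec, firstPos_vec, map_zero, add_zero, sub_zero]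
        exact ih _ _ hf (by rwa [Function.iterate_succ_apply, Function.iterate_succ_apply] at h)
  exact key 4 a b hab (by rw [firstLetter_iterate, firstLetter_iterate])

theorem nullOverlap_l1_vec_l5 {t : ℕ} {u : ℕ → Letter} (hu : IsFixedWord t u) (b : Letter) :
    NullOverlap t u b l1 (vec t l5) := by
  let j : Position (sigma t) := ⟨l1, 1, by simp [sigma]⟩
  have hj : j.vec t = vec t l1 := by
    simp [j, Position.vec, sigma, List.replicate_succ, wordVec_cons, wordVec_nil]
  -- The letter at `j` is `1` for `t ≥ 1` and `2` for `t = 0`. In every case the shift becomes `0`,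
  -- leaving a coincidence or an unshifted overlap of distinct tiles.
  by_cases h : firstLetter t b = j.letter
  · refine nullOverlap_of_coincidence hu (i := firstPos t b) (j := j) ?_ h ?_
    · intro h
      have : firstPos t l1 = j := by
        have h1 : b = l1 := congrArg Sigma.fst h
        rwa [h1] at h
      have := eq_of_heq (Sigma.mk.inj this).2
      simp at this
    · rw [firstPos_vec, hj, add_zero, contraction_vec_l5]
  · refine nullOverlap_of_positions hu (firstPos t b) j _ ?_
    rw [firstPos_vec, hj, add_zero, contraction_vec_l5, sub_self]
    exact nullOverlap_zero hu h

theorem nullOverlap_l1_vec_l4 {t : ℕ} {u : ℕ → Letter} (hu : IsFixedWord t u) (b : Letter) :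
    NullOverlap t u b l1 (vec t l4) := by
  -- The prefix `1^t` before this position cancels the term `t e_1` of `M e_4`, leaving the shift
  -- `e_5`.
  let j : Position (sigma t) := ⟨l1, t, by simp [sigma]⟩
  have hj : j.vec t = (t : ℝ) • vec t l1 := by
    simp [j, Position.vec, sigma, List.take_append, wordVec_replicate]
  have hl : j.letter = l1 := by
    simp [j, Position.letter, sigma, List.getElem_append_left]
  refine nullOverlap_of_positions hu (firstPos t b) j _ ?_
  rw [firstPos_vec, hj, hl, add_zero, contraction_vec_l4, add_sub_cancel_left]
  exact nullOverlap_l1_vec_l5 hu _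

theorem nullOverlap_vec_l3 {t : ℕ} {u : ℕ → Letter} (hu : IsFixedWord t u) (b : Letter)
    {a : Letter} (ha : firstLetter t a = l1) : NullOverlap t u b a (vec t l3) := by
  refine nullOverlap_of_positions hu (firstPos t b) (firstPos t a) _ ?_
  rw [firstPos_vec, firstPos_vec, add_zero, sub_zero, contraction_vec_l3]
  change NullOverlap t u _ (firstLetter t a) _
  rw [ha]
  exact nullOverlap_l1_vec_l4 hu _

/-! ### The aggregated word -/

theorem vec_eq_wordVec_chi (t : ℕ) (b : Letter) : vec t b = wordVec t (chi b) := by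
  cases b <;>
    simp [chi, wordVec_cons, wordVec_nil, vec_l3_add_vec_l4, vec_l3_add_vec_l2]

/-- The first letter of the image of a letter under `χ`. -/
def chiHead : Letter → Letter
  | l1 => l3
  | l2 => l2
  | l3 => l3
  | l4 => l4
  | l5 => l3

/-- Set equation for `χ` with `S = id`: first positions give the unshifted tiles, and the second
letters of `34` and `32` give the two shifted ones. -/
theorem mem_subtile_chi {t : ℕ} {u : ℕ → Letter} (hu : IsFixedWord t u) {c : Letter}
    {x : Kc t} : x ∈ subtile t (applyMorphism chi u) c ↔
      (∃ b, x ∈ subtile t u b ∧ chiHead b = c) ∨ (x - vec t l3 ∈ subtile t u l1 ∧ l4 = c) ∨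
        (x - vec t l3 ∈ subtile t u l5 ∧ l2 = c) := by
  have hmem : ∀ i : Position chi, x ∈ piece t u LinearMap.id i ↔
      x - i.vec t ∈ subtile t u i.1 := fun i => by
    constructor
    · rintro ⟨y, hy, rfl⟩
      simpa using hy
    · exact fun h => ⟨_, h, by simp⟩
  rw [subtile_applyMorphism chi_ne_nil (S := LinearMap.id) (vec_eq_wordVec_chi t)
    (isCompact_subtile hu)]
  simp only [Set.mem_iUnion, hmem, exists_prop]
  constructor
  · rintro ⟨⟨b, j⟩, rfl, h⟩
    cases b <;> simp only [chi, List.length_cons, List.length_nil] at j <;> fin_cases j <;>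
      simp [Position.vec, chi, wordVec_cons, wordVec_nil] at h
    · exact Or.inl ⟨_, h, rfl⟩
    · exact Or.inr (Or.inl ⟨h, rfl⟩)
    · exact Or.inl ⟨_, h, rfl⟩
    · exact Or.inl ⟨_, h, rfl⟩
    · exact Or.inl ⟨_, h, rfl⟩
    · exact Or.inl ⟨_, h, rfl⟩
    · exact Or.inr (Or.inr ⟨h, rfl⟩)
  · rintro (⟨b, h, rfl⟩ | ⟨h, rfl⟩ | ⟨h, rfl⟩)
    · refine ⟨⟨b, 0, List.length_pos_iff.2 (chi_ne_nil b)⟩, ?_, ?_⟩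
      · cases b <;> rfl
      · simpa [Position.vec, wordVec_nil] using h
    · refine ⟨⟨l1, (1 : Fin 2)⟩, rfl, ?_⟩
      simpa [Position.vec, chi, wordVec_cons, wordVec_nil] using h
    · refine ⟨⟨l5, (1 : Fin 2)⟩, rfl, ?_⟩
      simpa [Position.vec, chi, wordVec_cons, wordVec_nil] using h

/-! ### Almost everywhere uniqueness and the first return -/

theorem ae_subtile_unique {t : ℕ} {u : ℕ → Letter} (hu : IsFixedWord t u) :
    ∀ᵐ x ∂lebesgue t, ∀ a b, x ∈ subtile t u a → x ∈ subtile t u b → a = b := by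
  refine ae_all_iff.2 fun a => ae_all_iff.2 fun b => ?_
  by_cases hab : a = b
  · simp [hab]
  · refine measure_mono_null (fun x hx => ?_) (nullOverlap_zero hu hab)
    simpa [hab] using hx

theorem ae_notMem_translate {t : ℕ} {u : ℕ → Letter} (hu : IsFixedWord t u) :
    ∀ᵐ x ∂lebesgue t, ∀ a b, x ∈ subtile t u b → firstLetter t a = l1 →
      x - vec t l3 ∉ subtile t u a := by
  refine ae_all_iff.2 fun a => ae_all_iff.2 fun b => ?_
  by_cases ha : firstLetter t a = l1
  · refine measure_mono_null (fun x hx => ?_) (nullOverlap_vec_l3 hu b ha)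
    simpa [ha] using hx
  · simp [ha]

theorem ae_translate {t : ℕ} {p : Kc t → Prop} (h : ∀ᵐ x ∂lebesgue t, p x) (y : Kc t) :
    ∀ᵐ x ∂lebesgue t, p (x + y) :=
  (measurePreserving_add_right (lebesgue t) y).quasiMeasurePreserving.ae h

theorem ae_subtile_chi_unique {t : ℕ} {u : ℕ → Letter} (hu : IsFixedWord t u) :
    ∀ᵐ x ∂lebesgue t, ∀ a b, x ∈ subtile t (applyMorphism chi u) a →
      x ∈ subtile t (applyMorphism chi u) b → a = b := by
  have h := ae_subtile_unique hu
  filter_upwards [h, ae_translate h (-vec t l3), ae_notMem_translate hu] with x h1 h2 h3 a b ha hb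
  rw [← sub_eq_add_neg] at h2
  have h15 : x - vec t l3 ∈ subtile t u l1 → x - vec t l3 ∉ subtile t u l5 :=
    fun h h' => by cases h2 _ _ h h'
  have n1 : ∀ c, x ∈ subtile t u c → x - vec t l3 ∉ subtile t u l1 :=
    fun c hc => h3 _ c hc (firstLetter_l1 t)
  have n5 : ∀ c, x ∈ subtile t u c → x - vec t l3 ∉ subtile t u l5 := fun c hc => h3 _ c hc rfl
  rw [mem_subtile_chi hu] at ha hb
  rcases ha with ⟨c, hc, rfl⟩ | ⟨ha, rfl⟩ | ⟨ha, rfl⟩ <;>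
    rcases hb with ⟨d, hd, rfl⟩ | ⟨hb, rfl⟩ | ⟨hb, rfl⟩
  · rw [h1 _ _ hc hd]
  · exact absurd hb (n1 _ hc)
  · exact absurd hb (n5 _ hc)
  · exact absurd ha (n1 _ hd)
  · rfl
  · exact absurd hb (h15 ha)
  · exact absurd ha (n5 _ hd)
  · exact absurd ha (h15 hb)
  · rfl

theorem exchangeWellDefined_of_ae {t : ℕ} {w : ℕ → Letter}
    (h : ∀ᵐ x ∂lebesgue t, ∀ a b, x ∈ subtile t w a → x ∈ subtile t w b → a = b) :
    ExchangeWellDefined t w := by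
  refine ⟨fun a b hab => measure_mono_null ?_ (ae_iff.1 h), fun a x hx => add_vec_mem_fractal hx⟩
  exact fun x hx hn => hab (hn a b hx.1 hx.2)

theorem fractal_subset_fractal_chi {t : ℕ} {u : ℕ → Letter} (hu : IsFixedWord t u) :
    fractal t u ⊆ fractal t (applyMorphism chi u) :=
  Set.iUnion_subset fun a _ hx =>
    Set.mem_iUnion.2 ⟨chiHead a, (mem_subtile_chi hu).2 (Or.inl ⟨a, hx, rfl⟩)⟩

theorem isFirstReturn_exchange {t : ℕ} {u : ℕ → Letter} (hu : IsFixedWord t u) :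
    IsFirstReturn (lebesgue t) (exchange t (applyMorphism chi u)) (fractal t u)
      (exchange t u) := by
  have hchi := ae_subtile_chi_unique hu
  -- The translated statements control the intermediate point `x + vec t l3`: its tile for `χ(u)` is
  -- unique, and it avoids the fractal of `u`.
  filter_upwards [ae_subtile_unique hu, hchi, ae_translate hchi (vec t l3),
    ae_translate (ae_notMem_translate hu) (vec t l3)] with x h1 h2 h3 h4 hx
  obtain ⟨a, ha⟩ := Set.mem_iUnion.1 hx
  have hE : exchange t u x = x + vec t a := exchange_eq ha fun b hb => h1 _ _ hb ha
  have hR := add_vec_mem_fractal ha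
  have hF : x ∈ subtile t (applyMorphism chi u) (chiHead a) :=
    (mem_subtile_chi hu).2 (Or.inl ⟨a, ha, rfl⟩)
  have hF1 : exchange t (applyMorphism chi u) x = x + vec t (chiHead a) :=
    exchange_eq hF fun b hb => h2 _ _ hb hF
  have one : chiHead a = a → ∃ n, 1 ≤ n ∧
      (exchange t (applyMorphism chi u))^[n] x ∈ fractal t u ∧
      (∀ k, 1 ≤ k → k < n → (exchange t (applyMorphism chi u))^[k] x ∉ fractal t u) ∧
      exchange t u x = (exchange t (applyMorphism chi u))^[n] x := by
    intro h
    rw [h] at hF1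
    refine ⟨1, le_rfl, ?_, fun k hk hk' => absurd hk (by omega), ?_⟩
    · rwa [Function.iterate_one, hF1]
    · rw [Function.iterate_one, hF1, hE]
  have two : ∀ c, firstLetter t a = l1 → chiHead a = l3 → vec t l3 + vec t c = vec t a →
      x + vec t l3 ∈ subtile t (applyMorphism chi u) c → ∃ n, 1 ≤ n ∧
      (exchange t (applyMorphism chi u))^[n] x ∈ fractal t u ∧
      (∀ k, 1 ≤ k → k < n → (exchange t (applyMorphism chi u))^[k] x ∉ fractal t u) ∧
      exchange t u x = (exchange t (applyMorphism chi u))^[n] x := by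
    intro c hfa h hc hcx
    rw [h] at hF1
    have hF2 : (exchange t (applyMorphism chi u))^[2] x = x + vec t a := by
      rw [Function.iterate_succ_apply, Function.iterate_one, hF1,
        exchange_eq hcx fun b hb => h3 _ _ hb hcx, add_assoc, hc]
    refine ⟨2, one_le_two, hF2 ▸ hR, fun k hk hk' hmem => ?_, hE.trans hF2.symm⟩
    obtain rfl : k = 1 := by omega
    rw [Function.iterate_one, hF1] at hmem
    obtain ⟨b, hb⟩ := Set.mem_iUnion.1 hmem
    -- A return after one step would put `x + vec t l3` both in a tile of `u` and in the excluded
    -- translate of the tile `a`.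
    exact h4 a b hb hfa (by rwa [add_sub_cancel_right])
  cases a with
  | l1 =>
    exact two l4 (firstLetter_l1 t) rfl (vec_l3_add_vec_l4 t)
      ((mem_subtile_chi hu).2 (Or.inr (Or.inl ⟨by rwa [add_sub_cancel_right], rfl⟩)))
  | l5 =>
    exact two l2 rfl rfl (vec_l3_add_vec_l2 t)
      ((mem_subtile_chi hu).2 (Or.inr (Or.inr ⟨by rwa [add_sub_cancel_right], rfl⟩)))
  | l2 => exact one rfl
  | l3 => exact one rfl
  | l4 => exact one rfl

end Rauzy

theorem mainTheorem6 (t : ℕ) (u : ℕ → Letter) (hu : Rauzy.IsFixedWord t u) :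
    Rauzy.ExchangeWellDefined t u ∧
    Rauzy.ExchangeWellDefined t (Rauzy.applyMorphism Rauzy.chi u) ∧
    Rauzy.fractal t u ⊆ Rauzy.fractal t (Rauzy.applyMorphism Rauzy.chi u) ∧
    Rauzy.IsFirstReturn (Rauzy.lebesgue t)
      (Rauzy.exchange t (Rauzy.applyMorphism Rauzy.chi u))
      (Rauzy.fractal t u)
      (Rauzy.exchange t u) :=
  ⟨Rauzy.exchangeWellDefined_of_ae (Rauzy.ae_subtile_unique hu),
    Rauzy.exchangeWellDefined_of_ae (Rauzy.ae_subtile_chi_unique hu),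
    Rauzy.fractal_subset_fractal_chi hu, Rauzy.isFirstReturn_exchange hu⟩
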